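/- Conventions. All semigroups $S$ have a zero element $0$, and $E(S)$ denotes the set of idempotents of $S$; $S$ has local units if for every $s\in S$ there are $u,v\in E(S)$ with $us=s=sv$. Let $\Gamma$ be a group. A $\Gamma$-grading of $S$ is a map $\deg:S\setminus\{0\}\to\Gamma$ with $\deg(st)=\deg(s)\deg(t)$ whenever $st\neq 0$. A (pointed) left $S$-set is a set $X$ with an action satisfying $s(tx)=(st)x$ and with an element $0_X$ such that $0x=0_X$ for all $x\in X$. An $S$-map is a function $\phi$ with $\phi(sx)=s\phi(x)$. The set $S\otimes_S X$ is the quotient of $S\times X$ by the equivalence relation generated by $(st,x)\sim(s,tx)$, and $X$ is closed if the map $S\otimes_S X\to X$, $s\otimes x\mapsto sx$, is bijective. Write $S\text{-}\mathrm{FAct}$ for the category of closed left $S$-sets and $S$-maps. If $S$ is $\Gamma$-graded, a $\Gamma$-grading of a left $S$-set $X$ is a map $\deg:X\setminus\{0_X\}\to\Gamma$ with $\deg(sx)=\deg(s)\deg(x)$ whenever $sx\neq0_X$; put $X_\alpha=\{0_X\}\cup\deg^{-1}(\alpha)$. Write $S\text{-}\mathrm{FAct}^{\mathrm{gr}}$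 for the category of closed $\Gamma$-graded left $S$-sets, with morphisms the $S$-maps $\phi:X\to Y$ such that $\phi(X_\alpha)\subseteq Y_\alpha$ for all $\alpha\in\Gamma$. For $\alpha\in\Gamma$ the shift functor $\mathcal T_\alpha$ on $S\text{-}\mathrm{FAct}^{\mathrm{gr}}$ sends $X$ to the same $S$-set $X(\alpha)$ with components $X(\alpha)_\beta=X_{\beta\alpha}$, and sends each morphism to itself. Theorem 3.9. Let $S$ and $T$ be $\Gamma$-graded semigroups with local units. Suppose that $S$ and $T$ are graded Morita equivalent, i.e. there are functors $\mathcal F:S\text{-}\mathrm{FAct}^{\mathrm{gr}}\to T\text{-}\mathrm{FAct}^{\mathrm{gr}}$ and $\mathcal F':T\text{-}\mathrm{FAct}^{\mathrm{gr}}\to S\text{-}\mathrm{FAct}^{\mathrm{gr}}$ with $\mathcal F\mathcal T_\alpha=\mathcal T_\alpha\mathcal F$ and $\mathcal F'\mathcal T_\alpha=\mathcal T_\alpha\mathcal F'$ for all $\alpha\in\Gamma$, and with natural isomorphisms $\mathcal F'\mathcal F\cong 1$ and $\mathcal F\mathcal F'\cong 1$. Then $S$ and $T$ are Morita equivalent in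 the sense of Talwar: the categories $S\text{-}\mathrm{FAct}$ and $T\text{-}\mathrm{FAct}$ are equivalent. -/

import Mathlib

open CategoryTheory

universe u v

/-- Every element `s` has idempotents `a`, `b` with `a * s = s = s * b`. -/
def HasLocalUnits (S : Type u) [SemigroupWithZero S] : Prop :=
  ∀ s : S, ∃ a b : S, IsIdempotentElem a ∧ IsIdempotentElem b ∧ a * s = s ∧ s * b = s

/-- A grading of a semigroup with zero by a group: a degree map on the nonzero elements which
is multiplicative on nonzero products. -/
class GradedSemigroup (Γ : Type v) (S : Type u) [Group Γ] [SemigroupWithZero S] where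
  deg : {s : S // s ≠ 0} → Γ
  deg_mul : ∀ s t r : {s : S // s ≠ 0}, (s : S) * (t : S) = r → deg r = deg s * deg t

/-- A pointed left `S`-set. -/
class PointedAct (S : Type u) (X : Type u) [SemigroupWithZero S]
    extends Zero X, SemigroupAction S X where
  zero_act : ∀ x : X, (0 : S) • x = 0

/-- The generating identifications `(s * t, x) ~ (s, t • x)` of the tensor product
`S ⊗_S X`. -/
inductive ActTensorRel (S X : Type u) [SemigroupWithZero S] [PointedAct S X] :
    S × X → S × X → Prop
  | swap (s t : S) (x : X) : ActTensorRel S X (s * t, x) (s, t • x)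

/-- The tensor product `S ⊗_S X`: the quotient of `S × X` by the equivalence relation generated
by `ActTensorRel`. -/
def ActTensor (S X : Type u) [SemigroupWithZero S] [PointedAct S X] : Type u :=
  Quot (ActTensorRel S X)

/-- The canonical map `S ⊗_S X → X`, `s ⊗ x ↦ s • x`. -/
def ActTensor.toAct (S X : Type u) [SemigroupWithZero S] [PointedAct S X] :
    ActTensor S X → X :=
  Quot.lift (fun p : S × X => p.1 • p.2) (by
    rintro _ _ ⟨s, t, x⟩
    exact mul_smul s t x)

/-- A closed pointed left `S`-set: the canonical map `S ⊗_S X → X` is bijective. (Surjectivity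
says that `X` is unital, i.e. `S • X = X`.) -/
structure ClosedAct (S : Type u) [SemigroupWithZero S] where
  carrier : Type u
  [str : PointedAct S carrier]
  closed : Function.Bijective (ActTensor.toAct S carrier)

attribute [instance] ClosedAct.str

/-- The category of closed pointed left `S`-sets; its morphisms are all `S`-maps (which preserve
the zero elements automatically). -/
instance ClosedAct.instCategory (S : Type u) [SemigroupWithZero S] :
    Category.{u} (ClosedAct S) where
  Hom X Y := X.carrier →[S] Y.carrier
  id X := MulActionHom.id S
  comp f g := MulActionHom.comp g f

/-- A closed `Γ`-graded pointed left `S`-set: a degree map on the nonzero elements with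
`deg (s • x) = deg s * deg x` whenever `s • x ≠ 0`. -/
structure GradedClosedAct (Γ : Type v) (S : Type u) [Group Γ] [SemigroupWithZero S]
    [GradedSemigroup Γ S] extends ClosedAct S where
  deg : {x : carrier // x ≠ 0} → Γ
  deg_smul : ∀ (s : {s : S // s ≠ 0}) (x y : {x : carrier // x ≠ 0}),
    (s : S) • (x : carrier) = y → deg y = GradedSemigroup.deg s * deg x

namespace GradedClosedAct

variable {Γ : Type v} {S : Type u} [Group Γ] [SemigroupWithZero S] [GradedSemigroup Γ S]

/-- The component of degree `α`: the zero element and the nonzero elements of degree `α`. -/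
def component (X : GradedClosedAct Γ S) (α : Γ) : Set X.carrier :=
  {x | ∀ h : x ≠ 0, X.deg ⟨x, h⟩ = α}

/-- Graded `S`-maps. -/
@[ext]
structure Hom (X Y : GradedClosedAct Γ S) where
  toMap : X.carrier →[S] Y.carrier
  map_component : ∀ (α : Γ) (x : X.carrier), x ∈ X.component α → toMap x ∈ Y.component α

/-- The category of closed graded pointed left `S`-sets and graded `S`-maps. -/
instance instCategory : Category.{u} (GradedClosedAct Γ S) where
  Hom X Y := Hom X Y
  id X := ⟨MulActionHom.id S, fun _ _ h => h⟩
  comp f g := ⟨MulActionHom.comp g.toMap f.toMap,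
    fun α x h => g.map_component α _ (f.map_component α x h)⟩

/-- The shift `X(α)`: the same `S`-set, with the degree of each nonzero element multiplied by
`α⁻¹` on the right. -/
def shiftObj (α : Γ) (X : GradedClosedAct Γ S) : GradedClosedAct Γ S where
  toClosedAct := X.toClosedAct
  deg x := X.deg x * α⁻¹
  deg_smul s x y h := by rw [X.deg_smul s x y h, mul_assoc]

/-- The components of the shift: `X(α)_β = X_{β α}`. -/
theorem shiftObj_component (α β : Γ) (X : GradedClosedAct Γ S) :
    (shiftObj α X).component β = X.component (β * α) := by
  ext x
  exact forall_congr' fun h => mul_inv_eq_iff_eq_mul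

/-- The shift functor `X ↦ X(α)`, which takes each morphism to itself. -/
def shift (α : Γ) : GradedClosedAct Γ S ⥤ GradedClosedAct Γ S where
  obj X := shiftObj α X
  map {X Y} f := ⟨f.toMap, fun β x h => by
    have h' : x ∈ (shiftObj α X).component β := h
    rw [shiftObj_component] at h'
    have h'' : f.toMap x ∈ Y.component (β * α) := f.map_component _ x h'
    rw [← shiftObj_component] at h''
    exact h''⟩

end GradedClosedAct

/-- A graded functor: one that commutes, on the nose, with all shift functors. -/
def IsGradedFunctor {Γ : Type v} {S T : Type u} [Group Γ] [SemigroupWithZero S]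
    [SemigroupWithZero T] [GradedSemigroup Γ S] [GradedSemigroup Γ T]
    (F : GradedClosedAct Γ S ⥤ GradedClosedAct Γ T) : Prop :=
  ∀ α : Γ, GradedClosedAct.shift α ⋙ F = F ⋙ GradedClosedAct.shift α

/-- A graded equivalence: a graded functor with a graded quasi-inverse. -/
def IsGradedEquivalence {Γ : Type v} {S T : Type u} [Group Γ] [SemigroupWithZero S]
    [SemigroupWithZero T] [GradedSemigroup Γ S] [GradedSemigroup Γ T]
    (F : GradedClosedAct Γ S ⥤ GradedClosedAct Γ T) : Prop :=
  IsGradedFunctor F ∧ ∃ F' : GradedClosedAct Γ T ⥤ GradedClosedAct Γ S,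
    IsGradedFunctor F' ∧ Nonempty (F ⋙ F' ≅ 𝟭 (GradedClosedAct Γ S)) ∧
      Nonempty (F' ⋙ F ≅ 𝟭 (GradedClosedAct Γ T))

/-- Graded Morita equivalence: there is a graded equivalence between the categories of closed
graded left sets. -/
def GradedMoritaEquivalent (Γ : Type v) (S T : Type u) [Group Γ] [SemigroupWithZero S]
    [SemigroupWithZero T] [GradedSemigroup Γ S] [GradedSemigroup Γ T] : Prop :=
  ∃ F : GradedClosedAct Γ S ⥤ GradedClosedAct Γ T, IsGradedEquivalence F

/-- Morita equivalence of semigroups in the sense of Talwar: the categories of closed left sets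
are equivalent. -/
def MoritaEquivalent (S T : Type u) [SemigroupWithZero S] [SemigroupWithZero T] : Prop :=
  Nonempty (ClosedAct S ≌ ClosedAct T)

/-!
The proof describes closed `S`-acts in terms of the graded category and its shifts alone, so that
the description is carried along by a graded equivalence.

If `X` is a closed `S`-act, the smash product, with one copy of the nonzero elements of `X` for
every degree and action `s • (x, d) = (s • x, deg s * d)`, is a closed graded act
(`Smash.closed`; this uses local units). Right multiplication of the labels makes it an
equivariant object for the shifts. Conversely an equivariant graded act `Y` has an act of orbits,
which is again closed (`Orbits.closed`), and `Y` is the smash product of its orbit act, because an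
element of `Y` is determined by its orbit and its degree. So closed acts are equivalent to
equivariant graded acts (`smashFunctor_isEquivalence`). An equivalence of categories that commutes
with the shifts induces an equivalence of the categories of equivariant objects
(`EquivariantObject.mapFunctor_isEquivalence`), whence the theorem.

There is one complication of size: `Γ` may live in a larger universe than the acts, so labels in all
of `Γ` are not available. They are taken in a small group `D` embedded in `Γ` by `ι`, whose image
contains the degrees of `S`, `T`, `F S` and `F' T`, and only graded acts with degrees in that image
are considered. The functors preserve this condition (`supported_obj`): a nonzero element of degree
`β` in `F X` is a value of a nonzero map `T(β⁻¹) → F X`, and `F'` turns this map into a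
nonzero map `(F' T)(β⁻¹) → F' (F X) ≅ X`, which forces `β` to lie in the image of `ι`.
-/

/-! ### Equivariant objects of a category with a strict group action -/

section Equivariant

universe w v₁ u₁ v₂ u₂

/-- A strict action of a monoid on a category: the functors compose on the nose. -/
structure StrictAction (D : Type w) [Monoid D] (A : Type u₁) [Category.{v₁} A] where
  functor : D → A ⥤ A
  functor_one : functor 1 = 𝟭 A
  functor_mul : ∀ d e, functor e ⋙ functor d = functor (d * e)

variable {D : Type w} [Monoid D] {A : Type u₁} [Category.{v₁} A] {B : Type u₂} [Category.{v₂} B]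

/-- An equivariant object with the property `P`: an object with coherent morphisms to all its
translates. The unit and cocycle conditions involve `eqToHom`, since the action is strict. -/
structure EquivariantObject (σ : StrictAction D A) (P : ObjectProperty A) where
  obj : A
  prop : P obj
  act : ∀ d, obj ⟶ (σ.functor d).obj obj
  act_one : act 1 = eqToHom (Functor.congr_obj σ.functor_one obj).symm
  act_mul : ∀ d e, act (d * e) =
    act d ≫ (σ.functor d).map (act e) ≫ eqToHom (Functor.congr_obj (σ.functor_mul d e) obj)

namespace EquivariantObject

variable {σ : StrictAction D A} {P : ObjectProperty A} {τ : StrictAction D B}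
  {Q : ObjectProperty B}

/-- Morphisms of equivariant objects: the morphisms compatible with the translations. -/
@[ext]
structure Hom (X Y : EquivariantObject σ P) where
  hom : X.obj ⟶ Y.obj
  comm : ∀ d, X.act d ≫ (σ.functor d).map hom = hom ≫ Y.act d

instance : Category (EquivariantObject σ P) where
  Hom X Y := Hom X Y
  id X := ⟨𝟙 X.obj, fun d => by simp⟩
  comp f g := ⟨f.hom ≫ g.hom, fun d => by
    rw [Functor.map_comp, ← Category.assoc, f.comm, Category.assoc, g.comm, Category.assoc]⟩
  id_comp f := by ext; exact Category.id_comp _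
  comp_id f := by ext; exact Category.comp_id _
  assoc f g h := by ext; exact Category.assoc _ _ _

@[ext]
theorem hom_ext {X Y : EquivariantObject σ P} {f g : X ⟶ Y} (h : f.hom = g.hom) : f = g :=
  Hom.ext h

/-- An equivariant morphism that is invertible in the ambient category is invertible. -/
def isoMk {X Y : EquivariantObject σ P} (i : X.obj ≅ Y.obj)
    (h : ∀ d, X.act d ≫ (σ.functor d).map i.hom = i.hom ≫ Y.act d) : X ≅ Y where
  hom := ⟨i.hom, h⟩
  inv := ⟨i.inv, fun d => by
    rw [← cancel_epi i.hom, ← Category.assoc, ← h d, Category.assoc, ← Functor.map_comp]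
    simp⟩
  hom_inv_id := by ext; exact i.hom_inv_id
  inv_hom_id := by ext; exact i.inv_hom_id

variable (F : A ⥤ B) (hF : ∀ d, σ.functor d ⋙ F = F ⋙ τ.functor d)

/-- The functor between equivariant objects induced by a functor that commutes strictly with the
two actions. -/
def mapFunctor (hP : ∀ X, P X → Q (F.obj X)) : EquivariantObject σ P ⥤ EquivariantObject τ Q where
  obj X :=
    { obj := F.obj X.obj
      prop := hP _ X.prop
      act := fun d => F.map (X.act d) ≫ eqToHom (Functor.congr_obj (hF d) X.obj)
      act_one := by
        rw [X.act_one, eqToHom_map, eqToHom_trans]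
      act_mul := fun d e => by
        have h := Functor.congr_hom (hF d) (X.act e)
        simp only [Functor.comp_map] at h
        rw [X.act_mul]
        simp [h, eqToHom_map] }
  map {X Y} f :=
    { hom := F.map f.hom
      comm := fun d => by
        have h := Functor.congr_hom (hF d) f.hom
        simp only [Functor.comp_map] at h
        rw [← Category.assoc, ← Functor.map_comp, ← f.comm, Functor.map_comp, h]
        simp }
  map_id X := by ext; exact F.map_id _
  map_comp f g := by ext; exact F.map_comp _ _

theorem mapFunctor_isEquivalence [F.IsEquivalence] (hP : ∀ X, P X ↔ Q (F.obj X))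
    [Q.IsClosedUnderIsomorphisms] :
    (mapFunctor F hF fun X => (hP X).1).IsEquivalence where
  faithful := ⟨fun {X Y f g} h => by
    ext
    exact F.map_injective (congrArg Hom.hom h)⟩
  full := ⟨fun {X Y} f => by
    obtain ⟨g, hg⟩ := F.map_surjective (X := X.obj) (Y := Y.obj) f.hom
    refine ⟨⟨g, fun d => F.map_injective ?_⟩, ?_⟩
    · have h := Functor.congr_hom (hF d) g
      simp only [Functor.comp_map] at h
      have h' := f.comm d
      simp only [mapFunctor, Category.assoc, ← hg] at h'
      rw [Functor.map_comp, Functor.map_comp, h,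
        ← cancel_mono (eqToHom (Functor.congr_obj (hF d) Y.obj))]
      simpa using h'
    · ext
      exact hg⟩
  essSurj := ⟨fun Y => by
    -- Transport the equivariant structure of `Y` along `F X ≅ Y` and lift it through `F`.
    let i := F.objObjPreimageIso Y.obj
    let act : ∀ d, F.objPreimage Y.obj ⟶ (σ.functor d).obj (F.objPreimage Y.obj) := fun d =>
      F.preimage (i.hom ≫ Y.act d ≫ (τ.functor d).map i.inv ≫
        eqToHom (Functor.congr_obj (hF d) _).symm)
    have hact : ∀ d, F.map (act d) = i.hom ≫ Y.act d ≫ (τ.functor d).map i.inv ≫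
        eqToHom (Functor.congr_obj (hF d) _).symm := fun d => F.map_preimage _
    refine ⟨⟨F.objPreimage Y.obj, (hP _).2 (Q.prop_of_iso i.symm Y.prop), act, ?_, ?_⟩,
      ⟨isoMk i ?_⟩⟩
    · apply F.map_injective
      have h := Functor.congr_hom τ.functor_one i.inv
      rw [hact, Y.act_one, h]
      simp [eqToHom_map]
    · intro d e
      apply F.map_injective
      have h₁ := Functor.congr_hom (τ.functor_mul d e) i.inv
      have h₂ := Functor.congr_hom (hF d) (act e)
      simp only [Functor.comp_map] at h₁ h₂
      have h₃ : (τ.functor d).map ((τ.functor e).map i.inv) ≫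
          eqToHom (Functor.congr_obj (τ.functor_mul d e) _) =
          eqToHom (Functor.congr_obj (τ.functor_mul d e) _) ≫ (τ.functor (d * e)).map i.inv := by
        simp [h₁]
      rw [Functor.map_comp, Functor.map_comp, h₂, hact, hact, hact, Y.act_mul]
      have h₄ : (τ.functor d).map i.inv ≫ (τ.functor d).map i.hom = 𝟙 _ := by
        rw [← Functor.map_comp]; simp
      simp only [Functor.map_comp, Category.assoc, eqToHom_map, eqToHom_trans,
        eqToHom_trans_assoc, eqToHom_refl, Category.id_comp]
      rw [reassoc_of% h₄, h₁]
      simp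
    · intro d
      simp only [mapFunctor]
      rw [hact]
      simp [← Functor.map_comp]⟩

end EquivariantObject

end Equivariant

/-! ### Closed acts -/

section ClosedActs

variable {S : Type u} [SemigroupWithZero S]

theorem PointedAct.smul_zero' {X : Type u} [PointedAct S X] (s : S) : s • (0 : X) = 0 := by
  rw [← PointedAct.zero_act (S := S) (0 : X), ← mul_smul, mul_zero]

namespace ActTensor

variable {X Y : Type u} [PointedAct S X] [PointedAct S Y]

/-- The pure tensor `s ⊗ x`. -/
def tmul (s : S) (x : X) : ActTensor S X := Quot.mk _ (s, x)

@[simp]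
theorem toAct_tmul (s : S) (x : X) : toAct S X (tmul s x) = s • x := rfl

theorem mul_tmul (s t : S) (x : X) : tmul (s * t) x = tmul s (t • x) :=
  Quot.sound ⟨s, t, x⟩

theorem exists_tmul (p : ActTensor S X) : ∃ (s : S) (x : X), p = tmul s x := by
  obtain ⟨s, x⟩ := p
  exact ⟨s, x, rfl⟩

theorem tmul_eq_zero_of_smul_eq_zero (hS : HasLocalUnits S) {s : S} {x : X} (h : s • x = 0) :
    tmul s x = tmul 0 0 := by
  obtain ⟨a, -, -, -, ha, -⟩ := hS s
  have h0 := mul_tmul a 0 (0 : X)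
  rw [mul_zero, PointedAct.zero_act] at h0
  rw [← ha, mul_tmul, h, h0]

/-- An `S`-map induces a map of tensor products. -/
theorem tmul_map_eq (f : X →[S] Y) {s t : S} {x y : X} (h : tmul s x = tmul t y) :
    tmul s (f x) = tmul t (f y) := by
  have key : ∀ p q, ActTensorRel S X p q → tmul p.1 (f p.2) = tmul q.1 (f q.2) := by
    rintro _ _ ⟨s, t, x⟩
    simp only [map_smul, mul_tmul]
  exact congrArg (Quot.lift (fun p : S × X => tmul p.1 (f p.2)) key) h

theorem bijective_toAct (h₁ : ∀ x : X, ∃ (s : S) (y : X), s • y = x)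
    (h₂ : ∀ (s t : S) (x y : X), s • x = t • y → tmul s x = tmul t y) :
    Function.Bijective (toAct S X) := by
  refine ⟨fun p q h => ?_, fun x => ?_⟩
  · obtain ⟨s, x, rfl⟩ := exists_tmul p
    obtain ⟨t, y, rfl⟩ := exists_tmul q
    exact h₂ s t x y h
  · obtain ⟨s, y, h⟩ := h₁ x
    exact ⟨tmul s y, h⟩

end ActTensor

namespace ClosedAct

open ActTensor

theorem exists_smul_eq (X : ClosedAct S) (x : X.carrier) :
    ∃ (s : S) (y : X.carrier), s • y = x := by
  obtain ⟨p, hp⟩ := X.closed.2 x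
  obtain ⟨s, y, rfl⟩ := exists_tmul p
  exact ⟨s, y, hp⟩

theorem tmul_eq (X : ClosedAct S) {s t : S} {x y : X.carrier} (h : s • x = t • y) :
    tmul s x = tmul t y :=
  X.closed.1 h

theorem exists_unit_smul_eq (hS : HasLocalUnits S) (X : ClosedAct S) (x : X.carrier) :
    ∃ a : S, a • x = x := by
  obtain ⟨s, y, rfl⟩ := X.exists_smul_eq x
  obtain ⟨a, -, -, -, ha, -⟩ := hS s
  exact ⟨a, by rw [← mul_smul, ha]⟩

theorem map_zero' {X Y : ClosedAct S} (f : X.carrier →[S] Y.carrier) : f 0 = 0 := by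
  rw [← PointedAct.zero_act (S := S) (0 : X.carrier), map_smul, PointedAct.zero_act]

end ClosedAct

end ClosedActs

/-! ### Degrees and graded maps -/

section Degrees

variable {Γ : Type v} [Group Γ] {S : Type u} [SemigroupWithZero S] [GradedSemigroup Γ S]

namespace GradedClosedAct

theorem deg_eq_of_hom {X Y : GradedClosedAct Γ S} (f : X ⟶ Y) (x : X.carrier)
    (hx : x ≠ 0) (hy : f.toMap x ≠ 0) : Y.deg ⟨f.toMap x, hy⟩ = X.deg ⟨x, hx⟩ :=
  f.map_component (X.deg ⟨x, hx⟩) x (fun _ => rfl) hy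

/-- A graded map is built from an `S`-map preserving the degrees of nonzero elements. -/
def homMk {X Y : GradedClosedAct Γ S} (f : X.carrier →[S] Y.carrier)
    (hf : ∀ (x : X.carrier) (hx : x ≠ 0) (hy : f x ≠ 0), Y.deg ⟨f x, hy⟩ = X.deg ⟨x, hx⟩) :
    X ⟶ Y :=
  Hom.mk f fun α x hx hy => by
    have h0 : x ≠ 0 := by
      rintro rfl
      exact hy (ClosedAct.map_zero' f)
    rw [hf x h0 hy]
    exact hx h0

@[simp]
theorem comp_toMap_apply {X Y Z : GradedClosedAct Γ S} (f : X ⟶ Y) (g : Y ⟶ Z) (x : X.carrier) :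
    (f ≫ g).toMap x = g.toMap (f.toMap x) := rfl

@[simp]
theorem id_toMap_apply (X : GradedClosedAct Γ S) (x : X.carrier) :
    Hom.toMap (𝟙 X) x = x := rfl

theorem hom_ext {X Y : GradedClosedAct Γ S} {f g : X ⟶ Y} (h : ∀ x, f.toMap x = g.toMap x) :
    f = g :=
  Hom.ext (MulActionHom.ext h)

/-- A bijective graded map is an isomorphism. -/
noncomputable def isoOfBijective {X Y : GradedClosedAct Γ S} (f : X ⟶ Y)
    (hf : Function.Bijective f.toMap) : X ≅ Y where
  hom := f
  inv := homMk
    { toFun := (Equiv.ofBijective _ hf).symm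
      map_smul' := fun s y => by
        rw [Equiv.symm_apply_eq]
        simp only [Equiv.ofBijective_apply, map_smul, id]
        rw [Equiv.ofBijective_apply_symm_apply _ hf] } (fun y hy hx => by
      obtain ⟨x, rfl⟩ := hf.2 y
      have hsymm : (Equiv.ofBijective _ hf).symm (f.toMap x) = x :=
        Equiv.ofBijective_symm_apply_apply _ hf x
      have hx' : x ≠ 0 := by
        rintro rfl
        exact hy (ClosedAct.map_zero' f.toMap)
      rw [deg_eq_of_hom f x hx' hy]
      congr 2)
  hom_inv_id := hom_ext fun x => Equiv.ofBijective_symm_apply_apply _ hf x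
  inv_hom_id := hom_ext fun y => Equiv.ofBijective_apply_symm_apply _ hf y

theorem mk_congr (X : ClosedAct S) {deg deg' : {x : X.carrier // x ≠ 0} → Γ}
    (h : deg = deg') (hd hd') : GradedClosedAct.mk X deg hd = GradedClosedAct.mk X deg' hd' := by
  subst h
  rfl

/-- The canonical isomorphism between two graded acts which coincide up to their degree maps is
the identity on elements. -/
theorem eqToHom_toMap_apply (X : ClosedAct S) {deg deg' : {x : X.carrier // x ≠ 0} → Γ}
    (h : deg = deg') (hd hd') (p : GradedClosedAct.mk X deg hd = GradedClosedAct.mk X deg' hd')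
    (x : X.carrier) : (eqToHom p).toMap x = x := by
  subst h
  rfl

/-- The action of a group `D` on graded acts by shifts along `ι : D →* Γ`. -/
def shiftAction {D : Type u} [Group D] (ι : D →* Γ) :
    StrictAction D (GradedClosedAct Γ S) where
  functor d := shift (ι d)
  functor_one := by
    have hd : ∀ X : GradedClosedAct Γ S, (fun x => X.deg x * (ι 1)⁻¹) = X.deg := fun X => by
      simp
    refine CategoryTheory.Functor.ext (fun X => mk_congr X.toClosedAct (hd X) _ _)
      fun X Y f => hom_ext fun x => ?_
    exact (((eqToHom_toMap_apply Y.toClosedAct (hd Y).symm _ _ _ _).trans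
      (congrArg f.toMap (eqToHom_toMap_apply X.toClosedAct (hd X) _ _ _ x)))).symm
  functor_mul d e := by
    have hd : ∀ X : GradedClosedAct Γ S, (fun x => X.deg x * (ι e)⁻¹ * (ι d)⁻¹) =
        fun x => X.deg x * (ι (d * e))⁻¹ := fun X => by
      simp [mul_assoc]
    refine CategoryTheory.Functor.ext (fun X => mk_congr X.toClosedAct (hd X) _ _)
      fun X Y f => hom_ext fun x => ?_
    exact (((eqToHom_toMap_apply Y.toClosedAct (hd Y).symm _ _ _ _).trans
      (congrArg f.toMap (eqToHom_toMap_apply X.toClosedAct (hd X) _ _ _ x)))).symm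

/-- The graded acts all of whose degrees lie in the image of `ι`. -/
def supported {D : Type u} [Group D] (ι : D →* Γ) : ObjectProperty (GradedClosedAct Γ S) :=
  fun X => ∀ x, ∃ d, X.deg x = ι d

instance {D : Type u} [Group D] (ι : D →* Γ) :
    (supported (S := S) ι).IsClosedUnderIsomorphisms where
  of_iso {X Y} i hX y := by
    have h : i.hom.toMap (i.inv.toMap y.1) = y.1 := by
      rw [← comp_toMap_apply, i.inv_hom_id, id_toMap_apply]
    have hx : i.inv.toMap y.1 ≠ 0 := fun h0 =>
      y.2 (by rw [← h, h0]; exact ClosedAct.map_zero' i.hom.toMap)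
    obtain ⟨d, hd⟩ := hX ⟨_, hx⟩
    exact ⟨d, by rw [← hd, deg_eq_of_hom i.inv y.1 y.2 hx]⟩

end GradedClosedAct

end Degrees

/-! ### Equivariant graded acts in terms of elements -/

section Translation

variable {Γ : Type v} [Group Γ] {S : Type u} [SemigroupWithZero S] [GradedSemigroup Γ S]
  {D : Type u} [Group D] {ι : D →* Γ}

namespace GradedClosedAct

/-- Equivariant objects of the category of graded acts, for the shifts along `ι`, whose degrees
lie in the image of `ι`. They are the graded acts with a right action of `D` by `S`-maps which
translates degrees. -/
abbrev Equivariant (S : Type u) [SemigroupWithZero S] [GradedSemigroup Γ S] (ι : D →* Γ) :=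
  EquivariantObject (shiftAction (S := S) ι) (supported ι)

namespace Equivariant

/-- The right translation by `d` on the elements of an equivariant graded act. -/
def translate (Y : Equivariant S ι) (d : D) : Y.obj.carrier →[S] Y.obj.carrier :=
  (Y.act d).toMap

theorem translate_one (Y : Equivariant S ι) (y : Y.obj.carrier) : Y.translate 1 y = y := by
  have h := congrArg (fun f => Hom.toMap f y) Y.act_one
  refine h.trans ?_
  have hd : (fun x => Y.obj.deg x * (ι 1)⁻¹) = Y.obj.deg := by simp
  exact eqToHom_toMap_apply Y.obj.toClosedAct hd.symm _ _ _ y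

theorem translate_mul (Y : Equivariant S ι) (d e : D) (y : Y.obj.carrier) :
    Y.translate (d * e) y = Y.translate e (Y.translate d y) := by
  have h := congrArg (fun f => Hom.toMap f y) (Y.act_mul d e)
  refine h.trans ?_
  have hd : (fun x => Y.obj.deg x * (ι e)⁻¹ * (ι d)⁻¹) =
      fun x => Y.obj.deg x * (ι (d * e))⁻¹ := by
    simp [mul_assoc]
  exact eqToHom_toMap_apply Y.obj.toClosedAct hd _ _ _ _

theorem translate_ne_zero (Y : Equivariant S ι) (d : D) {y : Y.obj.carrier} (hy : y ≠ 0) :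
    Y.translate d y ≠ 0 := fun h => hy <| by
  rw [← Y.translate_one y, ← mul_inv_cancel d, Y.translate_mul, h, ClosedAct.map_zero']

theorem deg_translate (Y : Equivariant S ι) (d : D) {y : Y.obj.carrier} (hy : y ≠ 0) :
    Y.obj.deg ⟨_, Y.translate_ne_zero d hy⟩ = Y.obj.deg ⟨y, hy⟩ * ι d := by
  have h := deg_eq_of_hom (Y.act d) y hy (Y.translate_ne_zero d hy)
  exact mul_inv_eq_iff_eq_mul.1 h

/-- An equivariant graded act from its right translations. -/
def ofTranslate (X : GradedClosedAct Γ S) (hX : supported ι X)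
    (f : D → X.carrier →[S] X.carrier) (h_one : ∀ x, f 1 x = x)
    (h_mul : ∀ d e x, f (d * e) x = f e (f d x))
    (h_deg : ∀ d x (hx : x ≠ 0) (hy : f d x ≠ 0), X.deg ⟨f d x, hy⟩ = X.deg ⟨x, hx⟩ * ι d) :
    Equivariant S ι where
  obj := X
  prop := hX
  act d := homMk (Y := shiftObj (ι d) X) (f d) fun x hx hy =>
    mul_inv_eq_iff_eq_mul.2 (h_deg d x hx hy)
  act_one := hom_ext fun x => by
    have hd : (fun x => X.deg x * (ι 1)⁻¹) = X.deg := by simp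
    exact (h_one x).trans (eqToHom_toMap_apply X.toClosedAct hd.symm _ _ _ x).symm
  act_mul d e := hom_ext fun x => by
    have hd : (fun x => X.deg x * (ι e)⁻¹ * (ι d)⁻¹) = fun x => X.deg x * (ι (d * e))⁻¹ := by
      simp [mul_assoc]
    exact (h_mul d e x).trans (eqToHom_toMap_apply X.toClosedAct hd _ _ _ _).symm

theorem hom_translate {X Y : Equivariant S ι} (f : X ⟶ Y) (d : D) (x : X.obj.carrier) :
    f.hom.toMap (X.translate d x) = Y.translate d (f.hom.toMap x) :=
  congrArg (fun g => Hom.toMap g x) (f.comm d)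

end Equivariant

end GradedClosedAct

end Translation

/-! ### The smash product of an act with the grading group -/

section Smash

variable {Γ : Type v} [Group Γ] {S : Type u} [SemigroupWithZero S] [GradedSemigroup Γ S]
  {D : Type u} [Group D]

/-- A lift of the degree map of `S` along `ι : D →* Γ`, extended to `S` by an arbitrary value
at `0`. -/
structure DegreeLift (S : Type u) [SemigroupWithZero S] [GradedSemigroup Γ S] (ι : D →* Γ) where
  toFun : S → D
  map_mul : ∀ s t, s * t ≠ 0 → toFun (s * t) = toFun s * toFun t
  deg_eq : ∀ s : {s : S // s ≠ 0}, GradedSemigroup.deg s = ι (toFun s)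

theorem DegreeLift.nonempty {ι : D →* Γ} (hι : Function.Injective ι)
    (h : ∀ s : {s : S // s ≠ 0}, ∃ d, GradedSemigroup.deg s = ι d) :
    Nonempty (DegreeLift S ι) := by
  classical
  choose δ hδ using h
  refine ⟨⟨fun s => if hs : s ≠ 0 then δ ⟨s, hs⟩ else 1, fun s t hst => ?_, fun s => ?_⟩⟩
  · have hs : s ≠ 0 := by rintro rfl; simp at hst
    have ht : t ≠ 0 := by rintro rfl; simp at hst
    apply hι
    rw [dif_pos hst, dif_pos hs, dif_pos ht, _root_.map_mul, ← hδ, ← hδ, ← hδ]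
    exact GradedSemigroup.deg_mul ⟨s, hs⟩ ⟨t, ht⟩ ⟨s * t, hst⟩ rfl
  · rw [hδ, dif_pos s.2]

/-- Two pairs in `X × D` are identified when they are equal or both have first component `0`. -/
def smashSetoid (D X : Type u) [Zero X] : Setoid (X × D) where
  r p q := p.1 = q.1 ∧ (p.1 = 0 ∨ p.2 = q.2)
  iseqv :=
    { refl := fun _ => ⟨rfl, Or.inr rfl⟩
      symm := fun ⟨h₁, h₂⟩ => ⟨h₁.symm, h₂.imp (h₁ ▸ ·) Eq.symm⟩
      trans := fun ⟨h₁, h₂⟩ ⟨h₃, h₄⟩ => ⟨h₁.trans h₃, by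
        rcases h₂ with h₂ | h₂
        · exact Or.inl h₂
        · exact h₄.imp (h₁.trans ·) h₂.trans⟩ }

/-- The smash product of a pointed act `X` with the group `D`: one copy of the nonzero elements
of `X` for each element of `D`, and a zero element. -/
def Smash {ι : D →* Γ} (_ : DegreeLift S ι) (X : Type u) [PointedAct S X] : Type u :=
  Quotient (smashSetoid D X)

namespace Smash

open ActTensor

variable {ι : D →* Γ} {δ : DegreeLift S ι} {X : Type u} [PointedAct S X]

/-- The copy of `x` labelled by `d`. -/
def mk (δ : DegreeLift S ι) (x : X) (d : D) : Smash δ X := Quotient.mk (smashSetoid D X) (x, d)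

theorem mk_eq_mk {x y : X} {d e : D} : mk δ x d = mk δ y e ↔ x = y ∧ (x = 0 ∨ d = e) :=
  Quotient.eq (r := smashSetoid D X)

theorem exists_mk (p : Smash δ X) : ∃ x d, p = mk δ x d := by
  obtain ⟨x, d⟩ := p
  exact ⟨x, d, rfl⟩

/-- The underlying element of `X`. -/
def fst (p : Smash δ X) : X := Quotient.lift (s := smashSetoid D X) Prod.fst (fun _ _ h => h.1) p

@[simp]
theorem fst_mk (x : X) (d : D) : fst (mk δ x d) = x := rfl

/-- The label of a nonzero element; its value at the zero element is arbitrary. -/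
noncomputable def label (p : Smash δ X) : D := (Quotient.out (s := smashSetoid D X) p).2

theorem label_mk {x : X} (hx : x ≠ 0) (d : D) : label (mk δ x d) = d := by
  have h := Quotient.mk_out (s := smashSetoid D X) (x, d)
  exact h.2.resolve_left (fun h0 => hx (h.1.symm.trans h0))

/-- The action `s • (x, d) = (s • x, deg s * d)`. -/
instance : PointedAct S (Smash δ X) where
  zero := mk δ 0 1
  smul s := Quotient.map (sa := smashSetoid D X) (sb := smashSetoid D X)
    (fun p => (s • p.1, δ.toFun s * p.2)) (by
      rintro ⟨x, d⟩ ⟨y, e⟩ ⟨h₁, h₂⟩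
      simp only at h₁ h₂
      subst h₁
      refine ⟨rfl, ?_⟩
      rcases h₂ with rfl | rfl
      · exact Or.inl (PointedAct.smul_zero' s)
      · exact Or.inr rfl)
  mul_smul s t p := by
    obtain ⟨x, d, rfl⟩ := exists_mk p
    refine mk_eq_mk.2 ⟨mul_smul s t x, ?_⟩
    by_cases h : s * t = 0
    · exact Or.inl (by rw [h]; exact PointedAct.zero_act x)
    · exact Or.inr (by simp only [δ.map_mul s t h, mul_assoc])
  zero_act p := by
    obtain ⟨x, d, rfl⟩ := exists_mk p
    exact mk_eq_mk.2 ⟨PointedAct.zero_act x, Or.inl (PointedAct.zero_act x)⟩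

theorem smul_mk (s : S) (x : X) (d : D) : s • mk δ x d = mk δ (s • x) (δ.toFun s * d) := rfl

@[simp]
theorem mk_eq_zero {x : X} {d : D} : mk δ x d = 0 ↔ x = 0 :=
  mk_eq_mk.trans ⟨And.left, fun h => ⟨h, Or.inl h⟩⟩

theorem fst_smul (s : S) (p : Smash δ X) : fst (s • p) = s • fst p := by
  obtain ⟨x, d, rfl⟩ := exists_mk p
  rfl

/-- For `r : D`, the lift to the smash product of a pure tensor `s ⊗ x` with `s • x ≠ 0`, labelled
such that the product carries the label `r`. It is constant along the identifications defining
the tensor product. -/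
theorem tmul_mk_eq {s t : S} {x y : X} (r : D) (h : tmul s x = tmul t y) (hs : s • x ≠ 0) :
    tmul s (mk δ x ((δ.toFun s)⁻¹ * r)) = tmul t (mk δ y ((δ.toFun t)⁻¹ * r)) := by
  classical
  let φ : S × X → ActTensor S (Smash δ X) := fun p =>
    if p.1 • p.2 = 0 then tmul 0 0 else tmul p.1 (mk δ p.2 ((δ.toFun p.1)⁻¹ * r))
  have key : ∀ p q, ActTensorRel S X p q → φ p = φ q := by
    rintro _ _ ⟨s, t, x⟩
    simp only [φ, mul_smul]
    split_ifs with h0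
    · rfl
    · have hst : s * t ≠ 0 := fun h => h0 (by rw [← mul_smul, h, PointedAct.zero_act])
      rw [mul_tmul, smul_mk, δ.map_mul s t hst]
      congr 2
      group
  have ht : t • y ≠ 0 := by
    have := congrArg (toAct S X) h
    rw [toAct_tmul, toAct_tmul] at this
    rwa [← this]
  have := congrArg (Quot.lift φ key) h
  change φ (s, x) = φ (t, y) at this
  simpa only [φ, if_neg hs, if_neg ht] using this

theorem closed (hS : HasLocalUnits S) (hX : Function.Bijective (toAct S X)) :
    Function.Bijective (toAct S (Smash δ X)) := by
  refine bijective_toAct (fun p => ?_) fun s t p q h => ?_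
  · obtain ⟨x, d, rfl⟩ := exists_mk p
    obtain ⟨z, hz⟩ := hX.2 x
    obtain ⟨s, y, rfl⟩ := exists_tmul z
    rw [toAct_tmul] at hz
    exact ⟨s, mk δ y ((δ.toFun s)⁻¹ * d), by rw [smul_mk, hz, mul_inv_cancel_left]⟩
  · by_cases h0 : s • p = 0
    · rw [tmul_eq_zero_of_smul_eq_zero hS h0, tmul_eq_zero_of_smul_eq_zero hS (h.symm.trans h0)]
    · obtain ⟨x, d, rfl⟩ := exists_mk p
      obtain ⟨y, e, rfl⟩ := exists_mk q
      rw [smul_mk, mk_eq_zero] at h0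
      rw [smul_mk, smul_mk, mk_eq_mk] at h
      have hd := h.2.resolve_left h0
      have := tmul_mk_eq (δ := δ) (δ.toFun s * d) (hX.1 h.1 : tmul s x = tmul t y) h0
      rwa [inv_mul_cancel_left, hd, inv_mul_cancel_left] at this

/-- Right multiplication of the labels. -/
def translate (d : D) : Smash δ X →[S] Smash δ X where
  toFun := Quotient.map (sa := smashSetoid D X) (sb := smashSetoid D X)
    (fun p => (p.1, p.2 * d)) (fun _ _ ⟨h₁, h₂⟩ => ⟨h₁, h₂.imp_right (congrArg (· * d))⟩)
  map_smul' s p := by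
    obtain ⟨x, e, rfl⟩ := exists_mk p
    exact mk_eq_mk.2 ⟨rfl, Or.inr (mul_assoc _ _ _)⟩

theorem translate_mk (d e : D) (x : X) : translate d (mk δ x e) = mk δ x (e * d) := rfl

/-- Functoriality of the smash product. -/
def map {Y : Type u} [PointedAct S Y] (f : X →[S] Y) : Smash δ X →[S] Smash δ Y where
  toFun := Quotient.map (sa := smashSetoid D X) (sb := smashSetoid D Y)
    (fun p => (f p.1, p.2)) (by
      rintro ⟨x, d⟩ ⟨y, e⟩ ⟨h₁, h₂⟩
      simp only at h₁ h₂
      subst h₁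
      refine ⟨rfl, h₂.imp_left ?_⟩
      rintro rfl
      simp only
      rw [← PointedAct.zero_act (S := S) (0 : X), map_smul, PointedAct.zero_act])
  map_smul' s p := by
    obtain ⟨x, e, rfl⟩ := exists_mk p
    exact mk_eq_mk.2 ⟨map_smul f s x, Or.inr rfl⟩

end Smash

open GradedClosedAct

variable {ι : D →* Γ}

/-- The smash product as a graded act: the degree is given by the label. -/
noncomputable def smashGraded (hS : HasLocalUnits S) (δ : DegreeLift S ι) (X : ClosedAct S) :
    GradedClosedAct Γ S where
  carrier := Smash δ X.carrier
  closed := Smash.closed hS X.closed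
  deg p := ι (Smash.label p.1)
  deg_smul := by
    rintro s ⟨p, hp⟩ ⟨_, hq⟩ rfl
    obtain ⟨x, d, rfl⟩ := Smash.exists_mk p
    simp only [Smash.smul_mk] at hq ⊢
    rw [Smash.label_mk (fun h => hq (Smash.mk_eq_zero.2 h)),
      Smash.label_mk (fun h => hp (Smash.mk_eq_zero.2 h)), map_mul, δ.deg_eq]

theorem smashGraded_deg (hS : HasLocalUnits S) (δ : DegreeLift S ι) (X : ClosedAct S)
    {x : X.carrier} (hx : x ≠ 0) (d : D) (h : Smash.mk δ x d ≠ 0) :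
    (smashGraded hS δ X).deg ⟨Smash.mk δ x d, h⟩ = ι d :=
  congrArg ι (Smash.label_mk hx d)

/-- The smash product as an equivariant graded act. -/
noncomputable def smashEquivariant (hS : HasLocalUnits S) (δ : DegreeLift S ι)
    (X : ClosedAct S) : Equivariant S ι :=
  Equivariant.ofTranslate (smashGraded hS δ X) (fun _ => ⟨_, rfl⟩)
    (Smash.translate (δ := δ))
    (fun p => by
      obtain ⟨x, e, rfl⟩ := Smash.exists_mk (δ := δ) p
      exact congrArg (Smash.mk δ x) (mul_one e))
    (fun d d' p => by
      obtain ⟨x, e, rfl⟩ := Smash.exists_mk (δ := δ) p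
      exact congrArg (Smash.mk δ x) (mul_assoc e d d').symm)
    (fun d p hp hq => by
      obtain ⟨x, e, rfl⟩ := Smash.exists_mk (δ := δ) p
      have hx : x ≠ 0 := fun h => hp (Smash.mk_eq_zero.2 h)
      exact (smashGraded_deg hS δ X hx (e * d) _).trans
        ((map_mul ι e d).trans (congrArg (· * ι d) (smashGraded_deg hS δ X hx e _).symm)))

/-- The smash product functor from closed acts to equivariant graded acts. -/
noncomputable def smashFunctor (hS : HasLocalUnits S) (δ : DegreeLift S ι) :
    ClosedAct S ⥤ Equivariant S ι where
  obj X := smashEquivariant hS δ X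
  map {X Y} f :=
    { hom := homMk (X := smashGraded hS δ X) (Y := smashGraded hS δ Y) (Smash.map f)
        (fun p hp hq => by
          obtain ⟨x, d, rfl⟩ := Smash.exists_mk (δ := δ) p
          exact (smashGraded_deg hS δ Y (fun h => hq (Smash.mk_eq_zero.2 h)) d _).trans
            (smashGraded_deg hS δ X (fun h => hp (Smash.mk_eq_zero.2 h)) d _).symm)
      comm := fun d => GradedClosedAct.hom_ext fun p => by
        obtain ⟨x, e, rfl⟩ := Smash.exists_mk (δ := δ) p
        rfl }
  map_id X := EquivariantObject.hom_ext <| GradedClosedAct.hom_ext fun p => by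
    obtain ⟨x, e, rfl⟩ := Smash.exists_mk (δ := δ) p
    rfl
  map_comp f g := EquivariantObject.hom_ext <| GradedClosedAct.hom_ext fun p => by
    obtain ⟨x, e, rfl⟩ := Smash.exists_mk (δ := δ) p
    rfl

theorem smashFunctor_faithful (hS : HasLocalUnits S) (δ : DegreeLift S ι) :
    (smashFunctor hS δ).Faithful where
  map_injective {X Y f g} h := MulActionHom.ext fun x => by
    have h' := congrArg (fun k => k.hom.toMap (Smash.mk δ x 1)) h
    exact (Smash.mk_eq_mk (δ := δ).1 h').1

theorem smashFunctor_full (hS : HasLocalUnits S) (δ : DegreeLift S ι)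
    (hι : Function.Injective ι) : (smashFunctor hS δ).Full where
  map_surjective {X Y} f := by
    let φ : Smash δ X.carrier →[S] Smash δ Y.carrier := f.hom.toMap
    have hφ : ∀ x d, Smash.fst (φ (Smash.mk δ x d)) = Smash.fst (φ (Smash.mk δ x 1)) := by
      intro x d
      have h : φ (Smash.translate d (Smash.mk δ x 1)) =
          Smash.translate d (φ (Smash.mk δ x 1)) := Equivariant.hom_translate f d (Smash.mk δ x 1)
      rw [Smash.translate_mk, one_mul] at h
      rw [h]
      obtain ⟨y, e, hy⟩ := Smash.exists_mk (δ := δ) (φ (Smash.mk δ x 1))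
      rw [hy, Smash.translate_mk, Smash.fst_mk, Smash.fst_mk]
    let g : X.carrier →[S] Y.carrier :=
      { toFun := fun x => Smash.fst (φ (Smash.mk δ x 1))
        map_smul' := fun s x => by
          rw [← hφ (s • x) (δ.toFun s * 1), ← Smash.smul_mk, map_smul, Smash.fst_smul]
          rfl }
    refine ⟨g, EquivariantObject.hom_ext <| GradedClosedAct.hom_ext fun p => ?_⟩
    obtain ⟨x, d, rfl⟩ := Smash.exists_mk (δ := δ) p
    change Smash.mk δ (Smash.fst (φ (Smash.mk δ x 1))) d = φ (Smash.mk δ x d)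
    rw [← hφ x d]
    obtain ⟨y, e, hy⟩ := Smash.exists_mk (δ := δ) (φ (Smash.mk δ x d))
    rw [hy, Smash.fst_mk, Smash.mk_eq_mk]
    refine ⟨rfl, or_iff_not_imp_left.2 fun hy0 => hι ?_⟩
    have hne : Smash.mk δ y e ≠ 0 := fun h => hy0 (Smash.mk_eq_zero.1 h)
    have hx : x ≠ 0 := by
      rintro rfl
      have h0 : Smash.mk δ (0 : X.carrier) d = 0 := Smash.mk_eq_zero.2 rfl
      rw [h0] at hy
      exact hne (hy.symm.trans (ClosedAct.map_zero' f.hom.toMap))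
    have hdeg := deg_eq_of_hom f.hom (Smash.mk δ x d) (fun h => hx (Smash.mk_eq_zero.1 h))
      (fun h => hne (hy.symm.trans h))
    have h₁ : (smashGraded hS δ Y).deg ⟨Smash.mk δ y e, hne⟩ = ι e :=
      smashGraded_deg hS δ Y hy0 e hne
    have h₂ := hdeg.trans (smashGraded_deg hS δ X hx d _)
    rw [← h₂, ← h₁]
    congr 2

end Smash

/-! ### The orbit act of an equivariant graded act -/

section Orbits

open GradedClosedAct ActTensor

variable {Γ : Type v} [Group Γ] {S : Type u} [SemigroupWithZero S] [GradedSemigroup Γ S]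
  {D : Type u} [Group D] {ι : D →* Γ}

/-- Two elements of an equivariant graded act are identified when they are translates of each
other. -/
def orbitSetoid (Y : Equivariant S ι) : Setoid Y.obj.carrier where
  r x y := ∃ d, Y.translate d x = y
  iseqv :=
    { refl := fun x => ⟨1, Y.translate_one x⟩
      symm := by
        rintro x _ ⟨d, rfl⟩
        exact ⟨d⁻¹, by rw [← Y.translate_mul, mul_inv_cancel, Y.translate_one]⟩
      trans := by
        rintro x _ _ ⟨d, rfl⟩ ⟨e, rfl⟩
        exact ⟨d * e, Y.translate_mul d e x⟩ }

/-- The set of orbits of an equivariant graded act under translation. -/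
def Orbits (Y : Equivariant S ι) : Type u := Quotient (orbitSetoid Y)

namespace Orbits

variable {Y : Equivariant S ι}

/-- The orbit of an element. -/
def mk (y : Y.obj.carrier) : Orbits Y := Quotient.mk (orbitSetoid Y) y

theorem mk_eq_mk {x y : Y.obj.carrier} : mk x = mk y ↔ ∃ d, Y.translate d x = y :=
  Quotient.eq (r := orbitSetoid Y)

theorem exists_mk (p : Orbits Y) : ∃ y, p = mk y := by
  obtain ⟨y⟩ := p
  exact ⟨y, rfl⟩

instance : PointedAct S (Orbits Y) where
  zero := mk 0
  smul s := Quotient.map (sa := orbitSetoid Y) (sb := orbitSetoid Y) (fun y => s • y) (by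
    rintro x _ ⟨d, rfl⟩
    exact ⟨d, map_smul _ s x⟩)
  mul_smul s t p := by
    obtain ⟨y, rfl⟩ := exists_mk p
    exact congrArg mk (mul_smul s t y)
  zero_act p := by
    obtain ⟨y, rfl⟩ := exists_mk p
    exact congrArg mk (PointedAct.zero_act y)

/-- The projection onto the orbits, as an `S`-map. -/
def proj (Y : Equivariant S ι) : Y.obj.carrier →[S] Orbits Y where
  toFun := mk
  map_smul' _ _ := rfl

theorem mk_eq_zero {y : Y.obj.carrier} : mk y = 0 ↔ y = 0 := by
  refine ⟨fun h => ?_, fun h => congrArg mk h⟩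
  obtain ⟨d, hd⟩ := mk_eq_mk.1 h
  by_contra hy
  exact Y.translate_ne_zero d hy hd

/-- The orbits form a closed act: an equality `s • [x] = t • [y]` lifts to an equality in `Y`
after translating `x`. -/
theorem closed (Y : Equivariant S ι) : Function.Bijective (toAct S (Orbits Y)) := by
  refine bijective_toAct (fun p => ?_) fun s t p q h => ?_
  · obtain ⟨y, rfl⟩ := exists_mk p
    obtain ⟨s, x, rfl⟩ := Y.obj.exists_smul_eq y
    exact ⟨s, mk x, rfl⟩
  · obtain ⟨x, rfl⟩ := exists_mk p
    obtain ⟨y, rfl⟩ := exists_mk q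
    obtain ⟨d, hd⟩ := mk_eq_mk.1 h
    rw [map_smul] at hd
    have key := tmul_map_eq (proj Y) (Y.obj.tmul_eq hd)
    have hx : mk x = proj Y (Y.translate d x) := mk_eq_mk.2 ⟨d, rfl⟩
    rw [hx]
    exact key

end Orbits

/-- The closed act of orbits. -/
def orbitAct (Y : Equivariant S ι) : ClosedAct S where
  carrier := Orbits Y
  closed := Orbits.closed Y

theorem smashFunctor_essSurj (hS : HasLocalUnits S) (δ : DegreeLift S ι)
    (hι : Function.Injective ι) : (smashFunctor hS δ).EssSurj where
  mem_essImage Y := by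
    classical
    -- An element of `Y` is determined by its orbit and, if it is nonzero, by its degree.
    let ℓ : Y.obj.carrier → D := fun y => if hy : y ≠ 0 then (Y.prop ⟨y, hy⟩).choose else 1
    have hℓ : ∀ y (hy : y ≠ 0), Y.obj.deg ⟨y, hy⟩ = ι (ℓ y) := fun y hy => by
      simp only [ℓ, dif_pos hy]
      exact (Y.prop ⟨y, hy⟩).choose_spec
    have hℓ_smul : ∀ (s : S) (y : Y.obj.carrier), s • y ≠ 0 → ℓ (s • y) = δ.toFun s * ℓ y := by
      intro s y h
      have hs : s ≠ 0 := by
        rintro rfl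
        exact h (PointedAct.zero_act y)
      have hy : y ≠ 0 := by
        rintro rfl
        exact h (PointedAct.smul_zero' s)
      apply hι
      rw [map_mul, ← hℓ _ h, ← hℓ _ hy, ← δ.deg_eq ⟨s, hs⟩]
      exact Y.obj.deg_smul ⟨s, hs⟩ ⟨y, hy⟩ ⟨s • y, h⟩ rfl
    have hℓ_translate : ∀ d (y : Y.obj.carrier), y ≠ 0 → ℓ (Y.translate d y) = ℓ y * d := by
      intro d y hy
      apply hι
      rw [map_mul, ← hℓ _ hy, ← hℓ _ (Y.translate_ne_zero d hy), Y.deg_translate d hy]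
    let φ : Y.obj.carrier →[S] Smash δ (Orbits Y) :=
      { toFun := fun y => Smash.mk δ (Orbits.mk y) (ℓ y)
        map_smul' := fun s y => Smash.mk_eq_mk.2 ⟨rfl, or_iff_not_imp_left.2 fun h =>
          hℓ_smul s y fun h0 => h (Orbits.mk_eq_zero.2 h0)⟩ }
    have hφ : Function.Bijective φ := by
      constructor
      · intro x y h
        obtain ⟨h₁, h₂⟩ := Smash.mk_eq_mk.1 h
        obtain ⟨d, rfl⟩ := Orbits.mk_eq_mk.1 h₁
        by_cases hx : x = 0
        · rw [hx, ClosedAct.map_zero']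
        · have h₃ := h₂.resolve_left fun h0 => hx (Orbits.mk_eq_zero.1 h0)
          rw [hℓ_translate d x hx, left_eq_mul] at h₃
          rw [h₃, Y.translate_one]
      · intro p
        obtain ⟨o, d, rfl⟩ := Smash.exists_mk p
        obtain ⟨y, rfl⟩ := Orbits.exists_mk o
        refine ⟨Y.translate ((ℓ y)⁻¹ * d) y, Smash.mk_eq_mk.2
          ⟨(Orbits.mk_eq_mk.2 ⟨_, rfl⟩).symm, or_iff_not_imp_left.2 fun h => ?_⟩⟩
        have hy : y ≠ 0 := by
          rintro rfl
          exact h (Orbits.mk_eq_zero.2 (ClosedAct.map_zero' _))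
        rw [hℓ_translate _ y hy, mul_inv_cancel_left]
    let f : Y.obj ⟶ smashGraded hS δ (orbitAct Y) := homMk φ fun y hy hy' =>
      (smashGraded_deg hS δ (orbitAct Y) (fun h => hy (Orbits.mk_eq_zero.1 h)) _ _).trans
        (hℓ y hy).symm
    let i : Y ≅ smashEquivariant hS δ (orbitAct Y) :=
      EquivariantObject.isoMk (isoOfBijective f hφ) fun d => GradedClosedAct.hom_ext fun y => by
        change φ (Y.translate d y) = Smash.translate d (φ y)
        refine Smash.mk_eq_mk.2
          ⟨(Orbits.mk_eq_mk.2 ⟨_, rfl⟩).symm, or_iff_not_imp_left.2 fun h => ?_⟩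
        refine hℓ_translate d y ?_
        rintro rfl
        exact h (Orbits.mk_eq_zero.2 (ClosedAct.map_zero' _))
    exact ⟨orbitAct Y, ⟨i.symm⟩⟩

theorem smashFunctor_isEquivalence (hS : HasLocalUnits S) (δ : DegreeLift S ι)
    (hι : Function.Injective ι) : (smashFunctor hS δ).IsEquivalence where
  faithful := smashFunctor_faithful hS δ
  full := smashFunctor_full hS δ hι
  essSurj := smashFunctor_essSurj hS δ hι

end Orbits

/-! ### Graded functors and supports -/

section Supports

open GradedClosedAct ActTensor

variable {Γ : Type v} [Group Γ] {S T : Type u} [SemigroupWithZero S] [GradedSemigroup Γ S]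
  [SemigroupWithZero T] [GradedSemigroup Γ T]

instance SemigroupWithZero.pointedActSelf : PointedAct S S where
  smul s t := s * t
  mul_smul := mul_assoc
  zero_act := zero_mul

/-- A graded semigroup with local units as a graded closed left act over itself. -/
def regularAct (hS : HasLocalUnits S) : GradedClosedAct Γ S where
  carrier := S
  closed := by
    refine bijective_toAct (fun s => ?_) fun s s' t t' h => ?_
    · obtain ⟨a, -, -, -, ha, -⟩ := hS s
      exact ⟨a, s, ha⟩
    · -- With `a` a left unit of `p = s * t`, every tensor with product `p` equals `a ⊗ p`.
      obtain ⟨a, -, -, -, ha, -⟩ := hS (s * t)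
      have key : ∀ x y : S, x * y = s * t → tmul x y = tmul a (s * t) := by
        intro x y hxy
        obtain ⟨-, b, -, -, -, hb⟩ := hS y
        calc tmul x y = tmul x (y • b) := by rw [show y • b = y from hb]
          _ = tmul (a * (s * t)) b := by rw [← mul_tmul, hxy, ha]
          _ = tmul a ((s * t) • b) := mul_tmul _ _ _
          _ = tmul a (s * t) := by
            rw [← hxy, show (x * y) • b = x * y from by
              change x * y * b = x * y
              rw [mul_assoc, hb]]
      rw [key s t rfl, key s' t' h.symm]
  deg := GradedSemigroup.deg
  deg_smul s t r h := GradedSemigroup.deg_mul s t r h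

/-- The graded map `S(β⁻¹) → X`, `s ↦ s • y`, for an element `y` of degree `β`. -/
def regularActHom (hS : HasLocalUnits S) (X : GradedClosedAct Γ S) (y : X.carrier) (β : Γ)
    (hy : y ∈ X.component β) : (shift β⁻¹).obj (regularAct hS) ⟶ X :=
  homMk (X := shiftObj β⁻¹ (regularAct hS))
    { toFun := fun s : S => s • y
      map_smul' := fun s t => mul_smul s t y } (fun s hs hsy => by
      have hy0 : y ≠ 0 := by
        rintro rfl
        exact hsy (PointedAct.smul_zero' (S := S) s)
      have h := X.deg_smul ⟨s, hs⟩ ⟨y, hy0⟩ ⟨_, hsy⟩ rfl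
      rw [h, hy hy0]
      change _ = GradedSemigroup.deg (S := S) ⟨s, hs⟩ * β⁻¹⁻¹
      rw [inv_inv])

variable {D : Type u} [Group D] {ι : D →* Γ}

/-- Two graded acts whose degrees lie in different right cosets of the image of `ι` have only the
zero map between them. -/
theorem subsingleton_hom_of_supported {Z X : GradedClosedAct Γ S} (hZ : supported ι Z)
    (hX : supported ι X) {β : Γ} (hβ : ∀ d, β ≠ ι d) :
    Subsingleton ((shift β⁻¹).obj Z ⟶ X) := by
  have key : ∀ (f : (shift β⁻¹).obj Z ⟶ X) (z : Z.carrier), f.toMap z = 0 := by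
    intro f z
    by_contra hfz
    have hz : z ≠ 0 := by
      rintro rfl
      exact hfz (ClosedAct.map_zero' f.toMap)
    obtain ⟨d, hd⟩ := hZ ⟨z, hz⟩
    obtain ⟨e, he⟩ := hX ⟨_, hfz⟩
    have h : X.deg ⟨_, hfz⟩ = Z.deg ⟨z, hz⟩ * β⁻¹⁻¹ := deg_eq_of_hom f z hz hfz
    rw [hd, he, inv_inv] at h
    exact hβ (d⁻¹ * e) (by rw [map_mul, map_inv, h, inv_mul_cancel_left])
  exact ⟨fun f g => GradedClosedAct.hom_ext fun z => (key f z).trans (key g z).symm⟩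

/-- An equivalence preserves the property of having all degrees in the image of `ι`, provided that
its inverse `F'` is graded and sends the regular act to an act with this property. Indeed a nonzero
element of degree `β` in `F X` gives a nonzero map from `T(β⁻¹)`, hence one from `(F' T)(β⁻¹)` to
`X`. -/
theorem supported_obj (hT : HasLocalUnits T) (F : GradedClosedAct Γ S ⥤ GradedClosedAct Γ T)
    (F' : GradedClosedAct Γ T ⥤ GradedClosedAct Γ S) (hF' : IsGradedFunctor F') [F'.Faithful]
    (i : F ⋙ F' ≅ 𝟭 _) (hι : supported ι (F'.obj (regularAct hT)))
    {X : GradedClosedAct Γ S} (hX : supported ι X) : supported ι (F.obj X) := by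
  rintro ⟨y, hy⟩
  by_contra! hβ
  have hX' : supported ι (F'.obj (F.obj X)) :=
    (supported ι).prop_of_iso (i.app X).symm hX
  have h₁ := subsingleton_hom_of_supported hι hX' hβ
  have hobj := Functor.congr_obj (hF' ((F.obj X).deg ⟨y, hy⟩)⁻¹) (regularAct hT)
  simp only [Functor.comp_obj] at hobj
  rw [← hobj] at h₁
  obtain ⟨a, ha⟩ := (F.obj X).exists_unit_smul_eq hT y
  have h₂ : regularActHom hT (F.obj X) y _ (fun _ => rfl) =
      regularActHom hT (F.obj X) 0 ((F.obj X).deg ⟨y, hy⟩) (fun h => absurd rfl h) :=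
    F'.map_injective (h₁.elim _ _)
  have h₃ : a • y = a • (0 : (F.obj X).carrier) := congrArg (fun f => Hom.toMap f a) h₂
  exact hy (by rw [← ha, h₃, PointedAct.smul_zero'])

/-- Any small family of elements of a group lies in the image of an embedding of a small group. -/
theorem exists_small_group {I : Type u} (g : I → Γ) :
    ∃ (D : Type u) (_ : Group D) (ι : D →* Γ), Function.Injective ι ∧ ∀ i, ∃ d, g i = ι d :=
  ⟨FreeGroup I ⧸ (FreeGroup.lift g).ker, inferInstance, QuotientGroup.kerLift _,
    QuotientGroup.kerLift_injective _, fun i => ⟨QuotientGroup.mk (FreeGroup.of i), by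
      rw [QuotientGroup.kerLift_mk, FreeGroup.lift_apply_of]⟩⟩

end Supports

theorem theorem3p9 (Γ : Type v) [Group Γ] (S T : Type u) [SemigroupWithZero S]
    [SemigroupWithZero T] [GradedSemigroup Γ S] [GradedSemigroup Γ T]
    (hS : HasLocalUnits S) (hT : HasLocalUnits T) (h : GradedMoritaEquivalent Γ S T) :
    MoritaEquivalent S T := by
  obtain ⟨F, hF, F', hF', ⟨i⟩, ⟨j⟩⟩ := h
  let e : GradedClosedAct Γ S ≌ GradedClosedAct Γ T := CategoryTheory.Equivalence.mk F F' i.symm j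
  have : F.IsEquivalence := e.isEquivalence_functor
  have : F'.IsEquivalence := e.isEquivalence_inverse
  -- `Γ` may live in a larger universe than `S` and `T`, where the smash product with `Γ` would be
  -- too large; the subgroup generated by the relevant degrees is small enough.
  obtain ⟨D, _, ι, hι, hg⟩ := exists_small_group
    (Sum.elim (Sum.elim (GradedSemigroup.deg (Γ := Γ) (S := S))
      (GradedSemigroup.deg (Γ := Γ) (S := T)))
      (Sum.elim (F.obj (regularAct hS)).deg (F'.obj (regularAct hT)).deg))
  obtain ⟨δS⟩ := DegreeLift.nonempty (S := S) hι fun s => hg (.inl (.inl s))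
  obtain ⟨δT⟩ := DegreeLift.nonempty (S := T) hι fun t => hg (.inl (.inr t))
  have hFS : GradedClosedAct.supported ι (F.obj (regularAct hS)) := fun x => hg (.inr (.inl x))
  have hFT : GradedClosedAct.supported ι (F'.obj (regularAct hT)) := fun x => hg (.inr (.inr x))
  have hP : ∀ X, GradedClosedAct.supported ι X ↔ GradedClosedAct.supported ι (F.obj X) :=
    fun X => ⟨fun hX => supported_obj hT F F' hF' i hFT hX, fun hX =>
      (GradedClosedAct.supported ι).prop_of_iso (i.app X) (supported_obj hS F' F hF j hFS hX)⟩
  have := EquivariantObject.mapFunctor_isEquivalence (σ := GradedClosedAct.shiftAction ι)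
    (τ := GradedClosedAct.shiftAction ι) F (fun d => hF (ι d)) hP
  have := smashFunctor_isEquivalence hS δS hι
  have := smashFunctor_isEquivalence hT δT hι
  exact ⟨(smashFunctor hS δS).asEquivalence.trans <|
    (EquivariantObject.mapFunctor (σ := GradedClosedAct.shiftAction ι)
      (τ := GradedClosedAct.shiftAction ι) F (fun d => hF (ι d))
      fun X => (hP X).1).asEquivalence.trans (smashFunctor hT δT).asEquivalence.symm⟩
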